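/- Write $\mathbb{Q}$ for the real quaternions and let $n_3\ge 1$. Every third-order tensor $\mathcal A\in\mathbb{Q}^{n_1\times n_2\times n_3}$, with frontal slices $\mathcal A^{(1)},\dots,\mathcal A^{(n_3)}$, is written uniquely as $\mathcal A=\mathcal A_{\mathbf d}+\mathbf j\mathcal A_{\mathbf c}$ with complex tensors $\mathcal A_{\mathbf d},\mathcal A_{\mathbf c}$. For a tensor $\mathcal B$ let $\mathtt{unfold}(\mathcal B)$ be the block column of its frontal slices, $\mathtt{fold}$ the inverse operation, and $\mathtt{bcirc}(\mathcal B)$ the block circulant matrix whose $(s,t)$ block is $\mathcal B^{(s-t+1)}$ (upper index modulo $n_3$). Let $P_{n_3}$ be the permutation matrix with entry $1$ at $(s,t)$ exactly when $s+t\equiv 2 \pmod{n_3}$. Put $$\mathtt{bcirc_z}(\mathcal A)=\mathtt{bcirc}(\mathcal A_{\mathbf d})+\mathbf j\,\mathtt{bcirc}(\mathcal A_{\mathbf c})(P_{n_3}\otimes I_{n_2}),\qquad \mathcal A*_Q\mathcal B=\mathtt{fold}\big(\mathtt{bcirc_z}(\mathcal A)\,\mathtt{unfold}(\mathcal B)\big).$$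 Powers and inverses of tensors in $\mathbb{Q}^{n\times n\times n_3}$ are taken with respect to $*_Q$, whose identity $\mathcal I$ has first frontal slice $I_n$ and all other slices $0$. Let $F_{n_3}=\big(n_3^{-1/2}e^{-2\pi\mathbf i(s-1)(t-1)/n_3}\big)_{s,t}$. The matrix $(F_{n_3}\otimes I_n)\,\mathtt{bcirc_z}(\mathcal A)\,(F_{n_3}^*\otimes I_n)$ is block diagonal; its diagonal blocks are denoted $\hat{A}^{(1)},\dots,\hat{A}^{(n_3)}\in\mathbb{Q}^{n\times n}$. The QT-index $\operatorname{Ind}_{QT}(\mathcal A)$ is the least integer $k\ge 0$ such that $\operatorname{rank}\mathtt{bcirc_z}(\mathcal A^{k+1})=\operatorname{rank}\mathtt{bcirc_z}(\mathcal A^{k})$, where the rank of a quaternion matrix is the dimension of the right $\mathbb{Q}$-space spanned by its columns. A QT-group inverse of $\mathcal A$ is a tensor $\mathcal X\in\mathbb{Q}^{n\times n\times n_3}$ with $$\mathcal A*_Q\mathcal X*_Q\mathcal A=\mathcal A,\qquad \mathcal X*_Q\mathcal A*_Q\mathcal X=\mathcal X,\qquad \mathcal A*_Q\mathcal X=\mathcal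 X*_Q\mathcal A ;$$ it is written $\mathcal A^{\#}$ if it exists and is unique. A QT-Jordan decomposition of $\mathcal A$ is an identity $\mathcal A=\mathcal P*_Q\mathcal J*_Q\mathcal P^{-1}$ with $\mathcal P,\mathcal J\in\mathbb{Q}^{n\times n\times n_3}$, $\mathcal P$ invertible, and all blocks $\hat{J}^{(1)},\dots,\hat{J}^{(n_3)}$ in Jordan canonical form, i.e. direct sums of upper Jordan blocks whose eigenvalues are complex numbers with nonnegative imaginary part. **Corollary.** Let $\mathcal A\in\mathbb{Q}^{n\times n\times n_3}$ with $\operatorname{Ind}_{QT}(\mathcal A)=1$. Then $\mathcal A$ has a QT-Jordan decomposition, and for every QT-Jordan decomposition $\mathcal A=\mathcal P*_Q\mathcal J*_Q\mathcal P^{-1}$ the QT-group inverses $\mathcal A^{\#}$ and $\mathcal J^{\#}$ exist and are unique, and $$\mathcal A^{\#}=\mathcal P*_Q\mathcal J^{\#}*_Q\mathcal P^{-1}.$$ -/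

import Mathlib

open scoped Quaternion Kronecker Matrix

noncomputable section

namespace QT

/-! ### Quaternions and third-order quaternion tensors -/

/-- The quaternion unit `𝐣`. -/
def unitJ : ℍ[ℝ] := ⟨0, 0, 1, 0⟩

/-- The complex part `c₁ = a₀ + a₁ 𝐢` in the decomposition `a = c₁ + 𝐣 c₂`. -/
def dPart (a : ℍ[ℝ]) : ℂ := ⟨a.re, a.imI⟩

/-- The complex part `c₂ = a₂ - a₃ 𝐢` in the decomposition `a = c₁ + 𝐣 c₂`. -/
def cPart (a : ℍ[ℝ]) : ℂ := ⟨a.imJ, -a.imK⟩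

theorem dPart_add_unitJ_mul_cPart (a : ℍ[ℝ]) :
    (dPart a : ℍ[ℝ]) + unitJ * (cPart a : ℍ[ℝ]) = a := by
  have h₀ : unitJ.re = 0 := rfl
  have h₁ : unitJ.imI = 0 := rfl
  have h₂ : unitJ.imJ = 1 := rfl
  have h₃ : unitJ.imK = 0 := rfl
  ext <;> simp [dPart, cPart, h₀, h₁, h₂, h₃]

/-- Third-order tensors of size `n₁ × n₂ × n₃` with entries in `R`, given by their frontal slices.
All indices start at `0`, so the slice `A s` is the `(s + 1)`-st frontal slice. -/
abbrev Tensor (R : Type) (n₁ n₂ n₃ : ℕ) : Type := Fin n₃ → Matrix (Fin n₁) (Fin n₂) R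

variable {n₁ n₂ r n n₃ : ℕ}

/-- The complex tensor `A_𝐝` in `A = A_𝐝 + 𝐣 A_𝐜`. -/
def tensorD (A : Tensor ℍ[ℝ] n₁ n₂ n₃) : Tensor ℂ n₁ n₂ n₃ := fun s => (A s).map dPart

/-- The complex tensor `A_𝐜` in `A = A_𝐝 + 𝐣 A_𝐜`. -/
def tensorC (A : Tensor ℍ[ℝ] n₁ n₂ n₃) : Tensor ℂ n₁ n₂ n₃ := fun s => (A s).map cPart

/-- The stacking of the frontal slices into one block column. -/
def unfold {R : Type} (A : Tensor R n₁ n₂ n₃) : Matrix (Fin n₃ × Fin n₁) (Fin n₂) R :=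
  fun p b => A p.1 p.2 b

/-- The inverse of `unfold`. -/
def fold {R : Type} (M : Matrix (Fin n₃ × Fin n₁) (Fin n₂) R) : Tensor R n₁ n₂ n₃ :=
  fun s a b => M (s, a) b

/-! ### The `z`-block circulant matrix and the QT-product -/

variable [NeZero n₃]

/-- The block circulant matrix: its block in position `(s, t)` is the slice `s - t`, taken
modulo `n₃` (subtraction in `Fin n₃` is modular). -/
def bcirc {R : Type} (A : Tensor R n₁ n₂ n₃) :
    Matrix (Fin n₃ × Fin n₁) (Fin n₃ × Fin n₂) R :=
  fun p q => A (p.1 - q.1) p.2 q.2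

/-- The permutation matrix of `s ↦ -s` modulo `n₃` (addition in `Fin n₃` is modular). -/
def permP (n₃ : ℕ) [NeZero n₃] : Matrix (Fin n₃) (Fin n₃) ℍ[ℝ] :=
  fun s t => if s + t = 0 then 1 else 0

/-- `bcirc_z(A) = bcirc(A_𝐝) + 𝐣 bcirc(A_𝐜) (P ⊗ I)`. -/
def bcircZ (A : Tensor ℍ[ℝ] n₁ n₂ n₃) :
    Matrix (Fin n₃ × Fin n₁) (Fin n₃ × Fin n₂) ℍ[ℝ] :=
  (bcirc (tensorD A)).map (fun z : ℂ => (z : ℍ[ℝ])) +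
    unitJ • ((bcirc (tensorC A)).map (fun z : ℂ => (z : ℍ[ℝ])) *
      (permP n₃ ⊗ₖ (1 : Matrix (Fin n₂) (Fin n₂) ℍ[ℝ])))

/-- The QT-product. -/
def mul (A : Tensor ℍ[ℝ] n₁ r n₃) (B : Tensor ℍ[ℝ] r n₂ n₃) : Tensor ℍ[ℝ] n₁ n₂ n₃ :=
  fold (bcircZ A * unfold B)

infixl:70 " *Q " => QT.mul

/-- The identity tensor: its first frontal slice is the identity, all others vanish. -/
def identity (n n₃ : ℕ) [NeZero n₃] : Tensor ℍ[ℝ] n n n₃ := fun s => if s = 0 then 1 else 0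

/-- Powers with respect to the QT-product. -/
def pow (A : Tensor ℍ[ℝ] n n n₃) : ℕ → Tensor ℍ[ℝ] n n n₃
  | 0 => identity n n₃
  | k + 1 => pow A k *Q A

/-- `Q` is the (two-sided) inverse of `P` with respect to the QT-product. -/
def IsInverse (P Q : Tensor ℍ[ℝ] n n n₃) : Prop :=
  P *Q Q = identity n n₃ ∧ Q *Q P = identity n n₃

/-! ### QT-index and QT-group inverse -/

/-- The rank of a quaternion matrix: the dimension of the right `ℍ`-vector space spanned by its
columns (right vector spaces over `ℍ` are modules over the opposite ring). -/
def quatRank {ι κ : Type} (M : Matrix ι κ ℍ[ℝ]) : ℕ :=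
  Module.finrank ℍ[ℝ]ᵐᵒᵖ (Submodule.span ℍ[ℝ]ᵐᵒᵖ (Set.range fun b : κ => fun a : ι => M a b))

/-- The QT-rank entering the QT-index: the rank of the `z`-block circulant matrix. -/
def rank (A : Tensor ℍ[ℝ] n₁ n₂ n₃) : ℕ := quatRank (bcircZ A)

/-- The QT-index: the least `k` such that `A ^ (k + 1)` and `A ^ k` have the same QT-rank. -/
def index (A : Tensor ℍ[ℝ] n n n₃) : ℕ := sInf {k : ℕ | rank (pow A (k + 1)) = rank (pow A k)}

/-- `X` is a QT-group inverse of `A`: the defining equations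
`A^k * X * A = A^k`, `X * A * X = X`, `A * X = X * A` of the QT-Drazin inverse, with `k = 1`. -/
structure IsGroupInverse (A X : Tensor ℍ[ℝ] n n n₃) : Prop where
  mul_mul_self : A *Q X *Q A = A
  self_mul_mul : X *Q A *Q X = X
  comm : A *Q X = X *Q A

/-! ### QT-Jordan decomposition -/

/-- The normalized discrete Fourier matrix, `F s t = n₃^(-1/2) ω^(s t)`, `ω = exp(-2π𝐢/n₃)`,
seen as a quaternion matrix. -/
def dftMatrix (n₃ : ℕ) : Matrix (Fin n₃) (Fin n₃) ℍ[ℝ] := fun s t =>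
  (((Real.sqrt n₃ : ℂ)⁻¹ *
    Complex.exp (-2 * Real.pi * Complex.I / n₃) ^ ((s : ℕ) * (t : ℕ)) : ℂ) : ℍ[ℝ])

/-- The frontal slices `Â^(s)` of the Fourier transform of `A`: the diagonal blocks of
`(F ⊗ I) bcirc_z(A) (F* ⊗ I)`, which is a block diagonal matrix. -/
def hat (A : Tensor ℍ[ℝ] n₁ n₂ n₃) : Tensor ℍ[ℝ] n₁ n₂ n₃ := fun s a b =>
  ((dftMatrix n₃ ⊗ₖ (1 : Matrix (Fin n₁) (Fin n₁) ℍ[ℝ])) * bcircZ A *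
    ((dftMatrix n₃)ᴴ ⊗ₖ (1 : Matrix (Fin n₂) (Fin n₂) ℍ[ℝ]))) (s, a) (s, b)

/-- A quaternion matrix in Jordan canonical form, that is, a direct sum of (upper) Jordan blocks
whose eigenvalues are complex numbers with nonnegative imaginary part: the diagonal consists of
such numbers, each entry of the superdiagonal is `0`, or it is `1` and the two diagonal entries
next to it agree, and all other entries are `0`. -/
structure IsJordan (K : Matrix (Fin n) (Fin n) ℍ[ℝ]) : Prop where
  diag : ∀ a, ∃ z : ℂ, 0 ≤ z.im ∧ K a a = (z : ℍ[ℝ])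
  superdiag : ∀ a b : Fin n, (b : ℕ) = a + 1 → K a b = 0 ∨ (K a b = 1 ∧ K a a = K b b)
  off : ∀ a b : Fin n, b ≠ a → (b : ℕ) ≠ a + 1 → K a b = 0

/-- `A = P * J * P⁻¹` is a QT-Jordan decomposition of `A`, with `Pinv = P⁻¹`: the tensor `P` is
invertible and every frontal slice of the Fourier transform of `J` is in Jordan canonical form. -/
structure IsJordanDecomposition (A P Pinv J : Tensor ℍ[ℝ] n n n₃) : Prop where
  isInverse : IsInverse P Pinv
  eq : A = P *Q J *Q Pinv
  isJordan : ∀ s, IsJordan (hat J s)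

end QT

end

set_option linter.unusedSectionVars false

noncomputable section

namespace QT

/-! ### The Fourier transform of a tensor -/

variable {n₁ n₂ r n n₃ : ℕ}

/-! The Fourier transform along the third mode, with complex coefficients on the left, linearises
`*Q`: conjugation by `F ⊗ I` turns `bcircZ A` into the block diagonal matrix with blocks `fourier A
s` (`dftKron_mul_bcircZ`). Hence `fourier` is a bijection carrying `*Q` to the slicewise product
(`fourier_mul`, `fourier_injective`, `fourier_invFourier`), and inverses, group inverses and Jordan
decompositions can be studied in the ring of `n₃`-tuples of quaternion matrices.

Existence of the decomposition is then the Jordan form of each slice (`exists_jordan_form`). That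
form is built by splitting off one longest chain of generalized eigenvectors; an invariant
complement is the common kernel of a dual chain of functionals (`exists_jordan_chain`,
`exists_jordan_family`).

For the group inverse, index one says that `bcircZ A` and its square have equal rank, hence equal
column space, so `D = fourier A` satisfies `D = D * D * y`. The Artinian property supplies the left
counterpart `D = z * (D * D)`, and then `z * D * y` is a group inverse. Uniqueness holds in every
monoid, and conjugation by an invertible element carries group inverses to group inverses, which
relates `A` and `J`. -/

theorem unitJ_mul_coe (z : ℂ) : unitJ * (z : ℍ[ℝ]) = ((star z : ℂ) : ℍ[ℝ]) * unitJ := by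
  have h₀ : unitJ.re = 0 := rfl
  have h₁ : unitJ.imI = 0 := rfl
  have h₂ : unitJ.imJ = 1 := rfl
  have h₃ : unitJ.imK = 0 := rfl
  ext <;> simp [h₀, h₁, h₂, h₃]

theorem coe_mul_unitJ (z : ℂ) : (z : ℍ[ℝ]) * unitJ = unitJ * ((star z : ℂ) : ℍ[ℝ]) := by
  rw [unitJ_mul_coe, star_star]

theorem unitJ_mul_unitJ : unitJ * unitJ = -1 := by
  have h₀ : unitJ.re = 0 := rfl
  have h₁ : unitJ.imI = 0 := rfl
  have h₂ : unitJ.imJ = 1 := rfl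
  have h₃ : unitJ.imK = 0 := rfl
  ext <;> simp [h₀, h₁, h₂, h₃]

theorem star_coeComplex (z : ℂ) : star (z : ℍ[ℝ]) = ((star z : ℂ) : ℍ[ℝ]) := by
  ext <;> simp

theorem coeComplex_sum {ι : Type*} (s : Finset ι) (f : ι → ℂ) :
    ((∑ i ∈ s, f i : ℂ) : ℍ[ℝ]) = ∑ i ∈ s, (f i : ℍ[ℝ]) :=
  map_sum Quaternion.ofComplex f s

theorem coeComplex_comm (z w : ℂ) : (z : ℍ[ℝ]) * w = w * z := by
  rw [← Quaternion.coeComplex_mul, mul_comm, Quaternion.coeComplex_mul]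

/-- The root of unity `exp (-2π𝐢/n₃)`. -/
def omega (n₃ : ℕ) : ℂ := Complex.exp (-2 * Real.pi * Complex.I / n₃)

/-- The entries `ω^(st)` of the unnormalized discrete Fourier matrix. -/
def chi (s t : Fin n₃) : ℂ := omega n₃ ^ ((s : ℕ) * (t : ℕ))

/-- The discrete Fourier transform of a tensor along its third mode, with the complex
coefficients on the left. -/
def fourier (A : Tensor ℍ[ℝ] n₁ n₂ n₃) : Tensor ℍ[ℝ] n₁ n₂ n₃ :=
  fun s a b => ∑ t, (chi s t : ℍ[ℝ]) * A t a b

variable [NeZero n₃]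

/-! ### Characters of the cyclic group and unitarity of the Fourier matrix -/

theorem isPrimitiveRoot_omega : IsPrimitiveRoot (omega n₃) n₃ := by
  have h := (Complex.isPrimitiveRoot_exp n₃ (NeZero.ne n₃)).inv
  rw [← Complex.exp_neg] at h
  have h₁ : -(2 * Real.pi * Complex.I / n₃ : ℂ) = -2 * Real.pi * Complex.I / n₃ := by ring
  rwa [h₁] at h

theorem chi_add (s t u : Fin n₃) : chi s (t + u) = chi s t * chi s u := by
  rw [chi, chi, chi, pow_mul, pow_mul, pow_mul, ← pow_add, Fin.val_add]
  refine (pow_eq_pow_mod _ ?_).symm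
  rw [← pow_mul, mul_comm, pow_mul, isPrimitiveRoot_omega.pow_eq_one, one_pow]

theorem chi_comm (s t : Fin n₃) : chi s t = chi t s := by rw [chi, chi, mul_comm]

theorem chi_zero (s : Fin n₃) : chi s 0 = 1 := by simp [chi]

theorem star_chi_mul_chi (s t : Fin n₃) : star (chi s t) * chi s t = 1 := by
  have h : ‖chi s t‖ = 1 := by
    rw [chi, norm_pow, isPrimitiveRoot_omega.norm'_eq_one (NeZero.ne n₃), one_pow]
  rw [Complex.star_def, mul_comm, Complex.mul_conj, Complex.normSq_eq_norm_sq, h]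
  simp

theorem chi_sub (s t u : Fin n₃) : chi s (t - u) = chi s t * star (chi s u) := by
  have h : chi s t = chi s (t - u) * chi s u := by rw [← chi_add, sub_add_cancel]
  rw [h, mul_assoc, mul_comm (chi s u), star_chi_mul_chi, mul_one]

theorem sum_chi (t : Fin n₃) : ∑ s, chi s t = if t = 0 then (n₃ : ℂ) else 0 := by
  split_ifs with h
  · simp [h, chi_zero]
  · have h₁ : (omega n₃ ^ (t : ℕ)) ≠ 1 := by
      intro h₂
      have := isPrimitiveRoot_omega.pow_inj t.2 (NeZero.pos n₃) (by rw [h₂, pow_zero])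
      exact h (Fin.ext this)
    have h₂ : ∑ s : Fin n₃, chi s t = ∑ i ∈ Finset.range n₃, (omega n₃ ^ (t : ℕ)) ^ i := by
      rw [Finset.sum_range]
      exact Finset.sum_congr rfl fun s _ => by rw [chi_comm, chi, pow_mul]
    rw [h₂]
    have h₃ := mul_geom_sum (omega n₃ ^ (t : ℕ)) n₃
    rw [← pow_mul, mul_comm (t : ℕ), pow_mul, isPrimitiveRoot_omega.pow_eq_one, one_pow,
      sub_self] at h₃
    exact (mul_eq_zero.1 h₃).resolve_left (sub_ne_zero.2 h₁)

theorem sum_star_chi_mul_chi (t u : Fin n₃) :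
    ∑ s, star (chi s t) * chi s u = if t = u then (n₃ : ℂ) else 0 := by
  have h : ∀ s, star (chi s t) * chi s u = chi s (u - t) := fun s => by
    rw [chi_sub, mul_comm]
  simp_rw [h, sum_chi, sub_eq_zero, eq_comm]

theorem sum_chi_mul_star_chi (s u : Fin n₃) :
    ∑ t, chi s t * star (chi u t) = if s = u then (n₃ : ℂ) else 0 := by
  have h := sum_star_chi_mul_chi u s
  simp_rw [chi_comm _ s, chi_comm _ u, mul_comm (star _), eq_comm (a := u)] at h
  exact h

theorem dftMatrix_apply (s t : Fin n₃) :
    dftMatrix n₃ s t = (((Real.sqrt n₃ : ℂ)⁻¹ * chi s t : ℂ) : ℍ[ℝ]) := rfl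

theorem inv_sqrt_mul_inv_sqrt : (Real.sqrt n₃ : ℂ)⁻¹ * (Real.sqrt n₃ : ℂ)⁻¹ * n₃ = 1 := by
  have h : (Real.sqrt n₃ : ℂ) * (Real.sqrt n₃ : ℂ) = n₃ := by
    rw [← Complex.ofReal_mul, Real.mul_self_sqrt (Nat.cast_nonneg _), Complex.ofReal_natCast]
  have h₁ : (n₃ : ℂ) ≠ 0 := Nat.cast_ne_zero.2 (NeZero.ne n₃)
  rw [← mul_inv, h, inv_mul_cancel₀ h₁]

theorem dftMatrix_conjTranspose_mul : (dftMatrix n₃)ᴴ * dftMatrix n₃ = 1 := by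
  ext1 t u
  rw [Matrix.mul_apply]
  have h : ∀ s : Fin n₃, (dftMatrix n₃)ᴴ t s * dftMatrix n₃ s u =
      (((Real.sqrt n₃ : ℂ)⁻¹ * (Real.sqrt n₃ : ℂ)⁻¹ * (star (chi s t) * chi s u) : ℂ) : ℍ[ℝ]) := by
    intro s
    rw [Matrix.conjTranspose_apply, dftMatrix_apply, dftMatrix_apply, star_coeComplex,
      ← Quaternion.coeComplex_mul, star_mul']
    have : star (Real.sqrt n₃ : ℂ)⁻¹ = (Real.sqrt n₃ : ℂ)⁻¹ := by simp
    rw [this]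
    congr 1
    ring
  simp_rw [h, ← coeComplex_sum, ← Finset.mul_sum, sum_star_chi_mul_chi, Matrix.one_apply]
  split_ifs with h₁
  · rw [inv_sqrt_mul_inv_sqrt, Quaternion.coeComplex_one]
  · simp

theorem dftMatrix_mul_conjTranspose : dftMatrix n₃ * (dftMatrix n₃)ᴴ = 1 := by
  ext1 t u
  rw [Matrix.mul_apply]
  have h : ∀ s : Fin n₃, dftMatrix n₃ t s * (dftMatrix n₃)ᴴ s u =
      (((Real.sqrt n₃ : ℂ)⁻¹ * (Real.sqrt n₃ : ℂ)⁻¹ * (chi t s * star (chi u s)) : ℂ) : ℍ[ℝ]) := by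
    intro s
    rw [Matrix.conjTranspose_apply, dftMatrix_apply, dftMatrix_apply, star_coeComplex,
      ← Quaternion.coeComplex_mul, star_mul']
    have : star (Real.sqrt n₃ : ℂ)⁻¹ = (Real.sqrt n₃ : ℂ)⁻¹ := by simp
    rw [this]
    congr 1
    ring
  simp_rw [h, ← coeComplex_sum, ← Finset.mul_sum, sum_chi_mul_star_chi, Matrix.one_apply]
  split_ifs with h₁
  · rw [inv_sqrt_mul_inv_sqrt, Quaternion.coeComplex_one]
  · simp

/-- `M ⊗ I` is multiplicative in `M`, also over a noncommutative ring. -/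
theorem kronecker_one_mul_kronecker_one {R : Type*} [Ring R] {ι κ : Type*} [Fintype ι] [Fintype κ]
    [DecidableEq κ] (M N : Matrix ι ι R) :
    (M ⊗ₖ (1 : Matrix κ κ R)) * (N ⊗ₖ (1 : Matrix κ κ R)) = (M * N) ⊗ₖ (1 : Matrix κ κ R) := by
  ext ⟨i, k⟩ ⟨j, l⟩
  simp [Matrix.mul_apply, Fintype.sum_prod_type, Matrix.one_apply]

/-- The unitary matrix `F ⊗ I`. -/
def dftKron (n n₃ : ℕ) : Matrix (Fin n₃ × Fin n) (Fin n₃ × Fin n) ℍ[ℝ] :=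
  dftMatrix n₃ ⊗ₖ (1 : Matrix (Fin n) (Fin n) ℍ[ℝ])

/-- The unitary matrix `F* ⊗ I`. -/
def dftKronStar (n n₃ : ℕ) : Matrix (Fin n₃ × Fin n) (Fin n₃ × Fin n) ℍ[ℝ] :=
  (dftMatrix n₃)ᴴ ⊗ₖ (1 : Matrix (Fin n) (Fin n) ℍ[ℝ])

theorem dftKron_mul_dftKronStar : dftKron n n₃ * dftKronStar n n₃ = 1 := by
  rw [dftKron, dftKronStar, kronecker_one_mul_kronecker_one, dftMatrix_mul_conjTranspose,
    Matrix.one_kronecker_one]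

theorem dftKronStar_mul_dftKron : dftKronStar n n₃ * dftKron n n₃ = 1 := by
  rw [dftKron, dftKronStar, kronecker_one_mul_kronecker_one, dftMatrix_conjTranspose_mul,
    Matrix.one_kronecker_one]

/-- The block diagonal matrix with the frontal slices of `A` as diagonal blocks. -/
def blockDiag {R : Type} [Zero R] (A : Tensor R n₁ n₂ n₃) :
    Matrix (Fin n₃ × Fin n₁) (Fin n₃ × Fin n₂) R :=
  fun p q => if p.1 = q.1 then A p.1 p.2 q.2 else 0

theorem dftKron_mul_apply {κ : Type} (M : Matrix (Fin n₃ × Fin n) κ ℍ[ℝ]) (s : Fin n₃) (a : Fin n)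
    (q : κ) : (dftKron n n₃ * M) (s, a) q = ∑ t, dftMatrix n₃ s t * M (t, a) q := by
  simp [Matrix.mul_apply, Fintype.sum_prod_type, dftKron, Matrix.one_apply]

theorem blockDiag_mul_apply {κ : Type} (A : Tensor ℍ[ℝ] n₁ n₂ n₃)
    (M : Matrix (Fin n₃ × Fin n₂) κ ℍ[ℝ]) (s : Fin n₃) (a : Fin n₁) (q : κ) :
    (blockDiag A * M) (s, a) q = ∑ b, A s a b * M (s, b) q := by
  simp [Matrix.mul_apply, Fintype.sum_prod_type, blockDiag, Finset.sum_ite_eq]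

/-! ### Block diagonalisation of `bcircZ` and multiplicativity of the transform -/

theorem bcircZ_apply (A : Tensor ℍ[ℝ] n₁ n₂ n₃) (s t : Fin n₃) (a : Fin n₁) (b : Fin n₂) :
    bcircZ A (s, a) (t, b) =
      (dPart (A (s - t) a b) : ℍ[ℝ]) + unitJ * (cPart (A (s + t) a b) : ℍ[ℝ]) := by
  have h : ∀ u : Fin n₃, u + t = 0 ↔ u = -t := fun u => add_eq_zero_iff_eq_neg
  simp [bcircZ, Matrix.mul_apply, Fintype.sum_prod_type, bcirc, tensorD, tensorC, permP,
    Matrix.one_apply, h]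

theorem inv_sqrt_commute (q : ℍ[ℝ]) :
    (((Real.sqrt n₃ : ℂ)⁻¹ : ℂ) : ℍ[ℝ]) * q = q * (((Real.sqrt n₃ : ℂ)⁻¹ : ℂ) : ℍ[ℝ]) := by
  have : (((Real.sqrt n₃ : ℂ)⁻¹ : ℂ) : ℍ[ℝ]) = (((Real.sqrt n₃)⁻¹ : ℝ) : ℍ[ℝ]) := by
    rw [← Complex.ofReal_inv, Quaternion.coeComplex_coe]
  rw [this]
  exact Quaternion.coe_commutes _ _

theorem chi_mul_unitJ (s t : Fin n₃) :
    ((star (chi s t) : ℂ) : ℍ[ℝ]) * unitJ = unitJ * (chi s t : ℍ[ℝ]) := by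
  rw [unitJ_mul_coe]

/-- This explains the permutation in `bcircZ`. A shift by `t` leaves a factor `chi s t` that must be
moved to the right. It commutes with the complex part but is conjugated on passing `unitJ`; the
opposite shift, `s + t` instead of `s - t`, compensates for that. Both parts thus give the same
right factor. -/
theorem sum_dftMatrix_mul_bcircZ (A : Tensor ℍ[ℝ] n₁ n₂ n₃) (s t : Fin n₃) (a : Fin n₁)
    (b : Fin n₂) :
    ∑ u, dftMatrix n₃ s u * bcircZ A (u, a) (t, b) = fourier A s a b * dftMatrix n₃ s t := by
  have h₁ : ∑ u, (chi s u : ℍ[ℝ]) * (dPart (A (u - t) a b) : ℍ[ℝ]) =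
      ∑ u, (chi s u : ℍ[ℝ]) * (dPart (A u a b) : ℍ[ℝ]) * (chi s t : ℍ[ℝ]) := by
    refine (Fintype.sum_equiv (Equiv.addRight t) _ _ fun u => ?_).symm
    rw [Equiv.coe_addRight, add_sub_cancel_right, chi_add, Quaternion.coeComplex_mul, mul_assoc,
      mul_assoc, coeComplex_comm (dPart _)]
  have h₂ : ∑ u, (chi s u : ℍ[ℝ]) * (unitJ * (cPart (A (u + t) a b) : ℍ[ℝ])) =
      ∑ u, (chi s u : ℍ[ℝ]) * (unitJ * (cPart (A u a b) : ℍ[ℝ])) * (chi s t : ℍ[ℝ]) := by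
    refine Fintype.sum_equiv (Equiv.addRight t) _ _ fun u => ?_
    have h₃ : chi s u = chi s (u + t) * star (chi s t) := by rw [← chi_sub, add_sub_cancel_right]
    rw [Equiv.coe_addRight, h₃, Quaternion.coeComplex_mul, mul_assoc, mul_assoc, mul_assoc,
      coeComplex_comm (cPart _), ← mul_assoc _ unitJ, chi_mul_unitJ, mul_assoc]
  have h₃ : ∑ u, (chi s u : ℍ[ℝ]) * bcircZ A (u, a) (t, b) =
      fourier A s a b * (chi s t : ℍ[ℝ]) := by
    simp_rw [bcircZ_apply, mul_add, Finset.sum_add_distrib, h₁, h₂, ← Finset.sum_add_distrib,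
      ← add_mul, ← mul_add, dPart_add_unitJ_mul_cPart, fourier, Finset.sum_mul]
  simp_rw [dftMatrix_apply, Quaternion.coeComplex_mul, mul_assoc, ← Finset.mul_sum, h₃]
  rw [← mul_assoc, ← mul_assoc, inv_sqrt_commute]

theorem dftKron_mul_bcircZ (A : Tensor ℍ[ℝ] n₁ n₂ n₃) :
    dftKron n₁ n₃ * bcircZ A = blockDiag (fourier A) * dftKron n₂ n₃ := by
  ext1 ⟨s, a⟩ ⟨t, b⟩
  rw [dftKron_mul_apply, sum_dftMatrix_mul_bcircZ, blockDiag_mul_apply]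
  simp [dftKron, Matrix.one_apply]

theorem dftKron_mul_bcircZ_mul (A : Tensor ℍ[ℝ] n₁ n₂ n₃) :
    dftKron n₁ n₃ * bcircZ A * dftKronStar n₂ n₃ = blockDiag (fourier A) := by
  rw [dftKron_mul_bcircZ, Matrix.mul_assoc, dftKron_mul_dftKronStar, Matrix.mul_one]

theorem hat_eq_fourier (A : Tensor ℍ[ℝ] n₁ n₂ n₃) : hat A = fourier A := by
  funext s a b
  have h := congrFun (congrFun (dftKron_mul_bcircZ_mul A) (s, a)) (s, b)
  rw [blockDiag, if_pos rfl] at h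
  exact h

theorem dftKron_mul_unfold_apply (A : Tensor ℍ[ℝ] n₁ n₂ n₃) (s : Fin n₃) (a : Fin n₁)
    (b : Fin n₂) : (dftKron n₁ n₃ * unfold A) (s, a) b =
      (((Real.sqrt n₃ : ℂ)⁻¹ : ℂ) : ℍ[ℝ]) * fourier A s a b := by
  simp_rw [dftKron_mul_apply, dftMatrix_apply, Quaternion.coeComplex_mul, mul_assoc,
    ← Finset.mul_sum]
  rfl

theorem inv_sqrt_mul_cancel {p q : ℍ[ℝ]} (h : (((Real.sqrt n₃ : ℂ)⁻¹ : ℂ) : ℍ[ℝ]) * p =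
    (((Real.sqrt n₃ : ℂ)⁻¹ : ℂ) : ℍ[ℝ]) * q) : p = q := by
  have h₁ : (((Real.sqrt n₃ : ℂ)⁻¹ : ℂ) : ℍ[ℝ]) ≠ 0 := by
    have : (Real.sqrt n₃)⁻¹ ≠ 0 :=
      inv_ne_zero (Real.sqrt_ne_zero'.2 (Nat.cast_pos.2 (NeZero.pos n₃)))
    rw [← Complex.ofReal_inv, Quaternion.coeComplex_coe]
    exact fun h => this (Quaternion.coe_injective h)
  exact mul_left_cancel₀ h₁ h

/-- Apply `F ⊗ I` to `bcircZ A * unfold B` and move it past `bcircZ A`. The normalisation of `F` is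
a real, hence central, scalar and cancels. -/
theorem fourier_mul (A : Tensor ℍ[ℝ] n₁ r n₃) (B : Tensor ℍ[ℝ] r n₂ n₃) (s : Fin n₃) :
    fourier (A *Q B) s = fourier A s * fourier B s := by
  ext1 a b
  apply inv_sqrt_mul_cancel (n₃ := n₃)
  rw [← dftKron_mul_unfold_apply]
  have h : unfold (A *Q B) = bcircZ A * unfold B := rfl
  rw [h, ← Matrix.mul_assoc, dftKron_mul_bcircZ, Matrix.mul_assoc, blockDiag_mul_apply,
    Matrix.mul_apply, Finset.mul_sum]
  refine Finset.sum_congr rfl fun c _ => ?_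
  rw [dftKron_mul_unfold_apply, ← mul_assoc, ← mul_assoc, ← inv_sqrt_commute]

theorem fourier_identity : fourier (identity n n₃) = 1 := by
  funext s
  ext1 a b
  rw [fourier, Finset.sum_eq_single 0]
  · simp [identity, chi_zero]
  · intro t _ ht
    simp [identity, ht]
  · simp

/-- The inverse of `fourier`. -/
def invFourier (A : Tensor ℍ[ℝ] n₁ n₂ n₃) : Tensor ℍ[ℝ] n₁ n₂ n₃ :=
  fun t a b => ∑ s, (((n₃ : ℂ)⁻¹ * star (chi s t) : ℂ) : ℍ[ℝ]) * A s a b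

theorem fourier_invFourier (A : Tensor ℍ[ℝ] n₁ n₂ n₃) : fourier (invFourier A) = A := by
  have h₁ : (n₃ : ℂ) ≠ 0 := Nat.cast_ne_zero.2 (NeZero.ne n₃)
  funext s a b
  simp only [fourier, invFourier, Finset.mul_sum]
  rw [Finset.sum_comm]
  have h : ∀ u, ∑ t, (chi s t : ℍ[ℝ]) * ((((n₃ : ℂ)⁻¹ * star (chi u t) : ℂ) : ℍ[ℝ]) * A u a b) =
      (((n₃ : ℂ)⁻¹ * ∑ t, chi s t * star (chi u t) : ℂ) : ℍ[ℝ]) * A u a b := by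
    intro u
    rw [Finset.mul_sum, coeComplex_sum, Finset.sum_mul]
    refine Finset.sum_congr rfl fun t _ => ?_
    rw [← mul_assoc, ← Quaternion.coeComplex_mul, mul_left_comm]
  simp_rw [h, sum_chi_mul_star_chi]
  rw [Finset.sum_eq_single s]
  · rw [if_pos rfl, inv_mul_cancel₀ h₁, Quaternion.coeComplex_one, one_mul]
  · intro u _ hu
    rw [if_neg hu.symm]
    simp
  · simp

theorem invFourier_fourier (A : Tensor ℍ[ℝ] n₁ n₂ n₃) : invFourier (fourier A) = A := by
  have h₁ : (n₃ : ℂ) ≠ 0 := Nat.cast_ne_zero.2 (NeZero.ne n₃)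
  funext s a b
  simp only [fourier, invFourier, Finset.mul_sum]
  rw [Finset.sum_comm]
  have h : ∀ u, ∑ t, (((n₃ : ℂ)⁻¹ * star (chi t s) : ℂ) : ℍ[ℝ]) * ((chi t u : ℍ[ℝ]) * A u a b) =
      (((n₃ : ℂ)⁻¹ * ∑ t, star (chi t s) * chi t u : ℂ) : ℍ[ℝ]) * A u a b := by
    intro u
    rw [Finset.mul_sum, coeComplex_sum, Finset.sum_mul]
    refine Finset.sum_congr rfl fun t _ => ?_
    rw [← mul_assoc, ← Quaternion.coeComplex_mul, mul_assoc]
  simp_rw [h, sum_star_chi_mul_chi]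
  rw [Finset.sum_eq_single s]
  · rw [if_pos rfl, inv_mul_cancel₀ h₁, Quaternion.coeComplex_one, one_mul]
  · intro u _ hu
    rw [if_neg hu.symm]
    simp
  · simp

theorem fourier_injective :
    Function.Injective (fourier : Tensor ℍ[ℝ] n₁ n₂ n₃ → Tensor ℍ[ℝ] n₁ n₂ n₃) :=
  Function.LeftInverse.injective invFourier_fourier

/-! ### Jordan canonical form of quaternion matrices -/

section Functional

variable {V : Type*} [AddCommGroup V] [Module ℍ[ℝ] V] [Module ℂ V]

/-- An `ℍ`-linear endomorphism, seen as a `ℂ`-linear one. -/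
def complexEnd (hc : ∀ (z : ℂ) (x : V), z • x = (z : ℍ[ℝ]) • x) (f : V →ₗ[ℍ[ℝ]] V) :
    Module.End ℂ V where
  toFun := f
  map_add' := f.map_add
  map_smul' z x := by simp [hc]

/-- The `ℍ`-linear functional `w ↦ ψ(w) - 𝐣 ψ(𝐣 w)` with complex part `ψ`. -/
def quatFunctional (hc : ∀ (z : ℂ) (x : V), z • x = (z : ℍ[ℝ]) • x) (ψ : V →ₗ[ℂ] ℂ) :
    V →ₗ[ℍ[ℝ]] ℍ[ℝ] where
  toFun w := (ψ w : ℍ[ℝ]) - unitJ * (ψ (unitJ • w) : ℍ[ℝ])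
  map_add' x y := by
    simp only [smul_add, map_add, Quaternion.coeComplex_add, mul_add]
    abel
  map_smul' q w := by
    have h₁ : ∀ (z : ℂ) (x : V), ψ ((z : ℍ[ℝ]) • x) = z * ψ x := fun z x => by
      rw [← hc, map_smul, smul_eq_mul]
    have h₂ : ∀ (z : ℂ) (x : V), ψ (unitJ • (z : ℍ[ℝ]) • x) = star z * ψ (unitJ • x) :=
      fun z x => by rw [smul_smul, unitJ_mul_coe, mul_smul, h₁]
    have h₃ : ∀ x : V, unitJ • unitJ • x = -x := fun x => by
      rw [smul_smul, unitJ_mul_unitJ, neg_smul, one_smul]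
    obtain ⟨c, d, rfl⟩ : ∃ c d : ℂ, (c : ℍ[ℝ]) + unitJ * (d : ℍ[ℝ]) = q :=
      ⟨_, _, dPart_add_unitJ_mul_cPart q⟩
    simp only [add_smul, mul_smul, smul_add, map_add, h₁, h₂, h₃, map_neg, smul_eq_mul,
      RingHom.id_apply, Quaternion.coeComplex_add, Quaternion.coeComplex_mul]
    have h₄ : ∀ z : ℂ, ((-z : ℂ) : ℍ[ℝ]) = -(z : ℍ[ℝ]) := fun z => by ext <;> simp
    have h₅ : ∀ q : ℍ[ℝ], unitJ * (unitJ * q) = -q := fun q => by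
      rw [← mul_assoc, unitJ_mul_unitJ, neg_one_mul]
    have h₆ : ∀ (z : ℂ) (q : ℍ[ℝ]), (z : ℍ[ℝ]) * (unitJ * q) =
      unitJ * (((star z : ℂ) : ℍ[ℝ]) * q) := fun z q => by
        rw [← mul_assoc, coe_mul_unitJ, mul_assoc]
    simp only [mul_sub, add_mul, mul_add, mul_assoc, h₄, h₅, h₆,
      Quaternion.coeComplex_mul, mul_neg]
    abel

theorem quatFunctional_apply (hc : ∀ (z : ℂ) (x : V), z • x = (z : ℍ[ℝ]) • x) (ψ : V →ₗ[ℂ] ℂ)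
    (w : V) : quatFunctional hc ψ w = (ψ w : ℍ[ℝ]) - unitJ * (ψ (unitJ • w) : ℍ[ℝ]) := rfl

/-- The correction term `unitJ * z` with `z` complex has only `𝐣` and `𝐤` components, so it cannot
cancel the complex number `ψ w`. -/
theorem quatFunctional_ne_zero (hc : ∀ (z : ℂ) (x : V), z • x = (z : ℍ[ℝ]) • x)
    (ψ : V →ₗ[ℂ] ℂ) {w : V} (h : ψ w ≠ 0) : quatFunctional hc ψ w ≠ 0 := by
  intro h₁
  rw [quatFunctional_apply] at h₁
  have h₀ : unitJ.re = 0 := rfl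
  have h₁' : unitJ.imI = 0 := rfl
  have h₂ : unitJ.imJ = 1 := rfl
  have h₃ : unitJ.imK = 0 := rfl
  have h₄ := congrArg (fun q : ℍ[ℝ] => q.re) h₁
  have h₅ := congrArg (fun q : ℍ[ℝ] => q.imI) h₁
  simp [h₀, h₁', h₂, h₃] at h₄ h₅
  exact h (Complex.ext h₄ h₅)

/-- A complex eigenvalue exists, and multiplying its eigenvector by `unitJ` replaces the eigenvalue
by its conjugate. -/
theorem exists_eigenvalue_im_nonneg [FiniteDimensional ℂ V] [Nontrivial V]
    (hc : ∀ (z : ℂ) (x : V), z • x = (z : ℍ[ℝ]) • x) (f : V →ₗ[ℍ[ℝ]] V) :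
    ∃ (l : ℂ) (x : V), 0 ≤ l.im ∧ x ≠ 0 ∧ f x = l • x := by
  obtain ⟨l, hl⟩ := Module.End.exists_eigenvalue (complexEnd hc f)
  obtain ⟨x, hx⟩ := hl.exists_hasEigenvector
  have h₁ : f x = l • x := hx.apply_eq_smul
  rcases le_total 0 l.im with h | h
  · exact ⟨l, x, h, hx.2, h₁⟩
  · refine ⟨star l, unitJ • x, by simpa using h, ?_, ?_⟩
    · intro h₂
      have h₃ := congrArg (unitJ • ·) h₂
      simp only [smul_smul, unitJ_mul_unitJ, smul_zero, neg_smul, one_smul, neg_eq_zero] at h₃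
      exact hx.2 h₃
    · rw [map_smul, h₁, hc, hc, smul_smul, smul_smul, unitJ_mul_coe]

/-- The chain is `v j = T^j v` with `T = f - l` over `ℂ`, of the length at which the kernels of the
powers of `T` stabilise. The dual chain consists of the quaternionic extensions of `ψ ∘ T^i`, where
`ψ` kills the range of `T^k` and is nonzero on `T^(k-1) v`. The pairing `φ i (v j)` is therefore
antitriangular. -/
theorem exists_jordan_chain_complex [FiniteDimensional ℂ V] [Nontrivial V]
    (hc : ∀ (z : ℂ) (x : V), z • x = (z : ℍ[ℝ]) • x) (f : V →ₗ[ℍ[ℝ]] V) :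
    ∃ (k : ℕ) (l : ℂ) (v : ℕ → V) (φ : ℕ → V →ₗ[ℍ[ℝ]] ℍ[ℝ]), 0 < k ∧ 0 ≤ l.im ∧
      (∀ j, f (v j) = (l : ℍ[ℝ]) • v j + v (j + 1)) ∧ v k = 0 ∧
      (∀ i w, φ i (f w) = φ (i + 1) w + φ i w * (l : ℍ[ℝ])) ∧ φ k = 0 ∧
      (∀ i j, k ≤ i + j → φ i (v j) = 0) ∧ ∀ i j, i + j + 1 = k → φ i (v j) ≠ 0 := by
  classical
  obtain ⟨l, x, hl, hx₀, hx⟩ := exists_eigenvalue_im_nonneg hc f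
  let g := complexEnd hc f
  have hg : ∀ w, g w = f w := fun w => rfl
  let T : ℂ → Module.End ℂ V := fun z => g - algebraMap ℂ _ z
  have hT : ∀ z w, T z w = f w - z • w := fun z w => rfl
  have hTj : ∀ z w, unitJ • T z w = T (star z) (unitJ • w) := fun z w => by
    rw [hT, hT, smul_sub, map_smul, hc, hc, smul_smul, smul_smul, unitJ_mul_coe]
  have hTjpow : ∀ z (i : ℕ) w, unitJ • (T z ^ i) w = (T (star z) ^ i) (unitJ • w) := by
    intro z i
    induction i with
    | zero => intro w; rfl
    | succ i ih => intro w; rw [pow_succ, pow_succ, Module.End.mul_apply, Module.End.mul_apply,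
        ih, hTj]
  have hmono : ∀ i, LinearMap.ker (T l ^ i) ≤ LinearMap.ker (T l ^ (i + 1)) := fun i w hw => by
    rw [LinearMap.mem_ker] at hw ⊢
    rw [pow_succ', Module.End.mul_apply, hw, map_zero]
  have hex : ∃ i, LinearMap.ker (T l ^ i) = LinearMap.ker (T l ^ (i + 1)) := by
    obtain ⟨i, hi⟩ := monotone_stabilizes_iff_noetherian.2 (inferInstance : IsNoetherian ℂ V)
      ⟨fun i => LinearMap.ker (T l ^ i), monotone_nat_of_le_succ hmono⟩
    exact ⟨i, hi (i + 1) (Nat.le_succ i)⟩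
  obtain ⟨k, hk, hkmin⟩ : ∃ k, LinearMap.ker (T l ^ k) = LinearMap.ker (T l ^ (k + 1)) ∧
      ∀ m < k, LinearMap.ker (T l ^ m) ≠ LinearMap.ker (T l ^ (m + 1)) :=
    ⟨Nat.find hex, Nat.find_spec hex, fun m hm => Nat.find_min hex hm⟩
  -- Stabilisation at `0` would make `T l` injective, against the eigenvector `x`. From here on the
  -- chain length is `k + 1`.
  rcases k with _ | k
  · exfalso
    have h : x ∈ LinearMap.ker (T l ^ (0 + 1)) := by
      rw [LinearMap.mem_ker, zero_add, pow_one, hT, hx, sub_self]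
    rw [← hk, pow_zero, LinearMap.mem_ker] at h
    exact hx₀ h
  obtain ⟨v, hv, hv'⟩ : ∃ v ∈ LinearMap.ker (T l ^ (k + 1)), v ∉ LinearMap.ker (T l ^ k) := by
    by_contra! h
    exact hkmin k (Nat.lt_succ_self k) (le_antisymm (hmono k) h)
  rw [LinearMap.mem_ker] at hv hv'
  have hge : ∀ i, k + 1 ≤ i → (T l ^ i) v = 0 := fun i hi => by
    obtain ⟨d, rfl⟩ := Nat.exists_eq_add_of_le hi
    rw [add_comm, pow_add, Module.End.mul_apply, hv, map_zero]
  -- If `T^k v = T^(k+1) w`, then `w` lies in the stabilised kernel, which forces `T^k v = 0`.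
  have hrange : (T l ^ k) v ∉ LinearMap.range (T l ^ (k + 1)) := by
    rintro ⟨w, hw⟩
    have h₁ : w ∈ LinearMap.ker (T l ^ (k + 1 + 1)) := by
      rw [LinearMap.mem_ker, pow_succ', Module.End.mul_apply, hw, ← Module.End.mul_apply,
        ← pow_succ', hv]
    rw [← hk, LinearMap.mem_ker, hw] at h₁
    exact hv' h₁
  obtain ⟨ψ, hψ, hψrange⟩ := Submodule.exists_le_ker_of_notMem hrange
  have hψT : ∀ i w, k + 1 ≤ i → ψ ((T l ^ i) w) = 0 := fun i w hi => by
    obtain ⟨d, rfl⟩ := Nat.exists_eq_add_of_le hi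
    rw [pow_add, Module.End.mul_apply]
    exact hψrange ⟨_, rfl⟩
  refine ⟨k + 1, l, fun j => (T l ^ j) v, fun i => quatFunctional hc (ψ ∘ₗ (T l ^ i)),
    Nat.succ_pos k, hl, ?_, hv, ?_, ?_, ?_, ?_⟩
  · intro j
    change f _ = (l : ℍ[ℝ]) • _ + (T l ^ (j + 1)) v
    rw [pow_succ', Module.End.mul_apply, hT, ← hc, add_sub_cancel]
  · intro i w
    have h₁ : ∀ w, ψ ((T l ^ i) (f w)) = ψ ((T l ^ (i + 1)) w) + l * ψ ((T l ^ i) w) := fun w => by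
      rw [pow_succ, Module.End.mul_apply, hT, map_sub, map_sub, map_smul, map_smul, smul_eq_mul,
        sub_add_cancel]
    simp only [quatFunctional_apply, LinearMap.comp_apply, ← map_smul f, h₁,
      Quaternion.coeComplex_add, Quaternion.coeComplex_mul, mul_add, sub_mul, mul_assoc,
      coeComplex_comm l]
    abel
  · ext w
    all_goals simp [quatFunctional_apply, hψT]
  · intro i j hij
    -- The `𝐣`-part of `φ i (v j)`. For real `l`, `unitJ` commutes with `T l`. Otherwise `unitJ • v
    -- j` is a generalized eigenvector for `star l ≠ l`, and a Bézout identity puts it in the range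
    -- of `T l ^ (k + 1)`, which `ψ` kills.
    have h₁ : ψ ((T l ^ i) (unitJ • (T l ^ j) v)) = 0 := by
      by_cases hreal : star l = l
      · rw [hTjpow, hreal, ← Module.End.mul_apply, ← pow_add]
        have h₂ := hTjpow l (i + j) v
        rw [hge _ hij, hreal, smul_zero] at h₂
        rw [← h₂, map_zero]
      · have hcop : IsCoprime ((Polynomial.X - Polynomial.C (star l)) ^ (k + 1))
            ((Polynomial.X - Polynomial.C l) ^ (k + 1)) :=
          (Polynomial.isCoprime_X_sub_C_of_isUnit_sub
            (IsUnit.mk0 _ (sub_ne_zero.2 hreal))).pow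
        obtain ⟨a, b, hab⟩ := hcop
        have haeval : ∀ z, Polynomial.aeval g (Polynomial.X - Polynomial.C z) = T z := fun z => by
          simp [T]
        set u := unitJ • (T l ^ j) v with hu
        have hu₀ : (T (star l) ^ (k + 1)) u = 0 := by
          rw [hu, ← hTjpow, ← Module.End.mul_apply, ← pow_add, hge _ (Nat.le_add_right _ _),
            smul_zero]
        have h₂ := congrArg (fun p => Polynomial.aeval g p u) hab
        simp only [map_add, map_mul, map_pow, haeval, LinearMap.add_apply, Module.End.mul_apply,
          hu₀, map_zero, zero_add, map_one, Module.End.one_apply] at h₂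
        have h₃ : Polynomial.aeval g b * T l ^ (k + 1) = T l ^ (k + 1) * Polynomial.aeval g b := by
          rw [← haeval, ← map_pow, ← map_mul, ← map_mul, mul_comm]
        rw [← Module.End.mul_apply, h₃, Module.End.mul_apply] at h₂
        rw [← h₂, ← Module.End.mul_apply, ← pow_add]
        exact hψT _ _ (Nat.le_add_left _ _)
    simp only [quatFunctional_apply, LinearMap.comp_apply, h₁]
    rw [← Module.End.mul_apply, ← pow_add, hge _ hij]
    simp
  · intro i j hij
    apply quatFunctional_ne_zero
    rw [LinearMap.comp_apply, ← Module.End.mul_apply, ← pow_add]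
    obtain rfl : i + j = k := by omega
    exact hψ

end Functional

/-- Scalars are restricted along `ℂ → ℍ`; finiteness over `ℂ` comes from that of `ℍ` over `ℝ`. -/
theorem exists_jordan_chain {V : Type*} [AddCommGroup V] [Module ℍ[ℝ] V]
    [FiniteDimensional ℍ[ℝ] V] [Nontrivial V] (f : V →ₗ[ℍ[ℝ]] V) :
    ∃ (k : ℕ) (l : ℂ) (v : ℕ → V) (φ : ℕ → V →ₗ[ℍ[ℝ]] ℍ[ℝ]), 0 < k ∧ 0 ≤ l.im ∧
      (∀ j, f (v j) = (l : ℍ[ℝ]) • v j + v (j + 1)) ∧ v k = 0 ∧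
      (∀ i w, φ i (f w) = φ (i + 1) w + φ i w * (l : ℍ[ℝ])) ∧ φ k = 0 ∧
      (∀ i j, k ≤ i + j → φ i (v j) = 0) ∧ ∀ i j, i + j + 1 = k → φ i (v j) ≠ 0 := by
  let : Module ℂ V := Module.compHom V (Quaternion.ofComplex : ℂ →+* ℍ[ℝ])
  let : Module ℂ ℍ[ℝ] := Module.compHom ℍ[ℝ] (Quaternion.ofComplex : ℂ →+* ℍ[ℝ])
  have : IsScalarTower ℂ ℍ[ℝ] V := ⟨fun z q x => mul_smul (z : ℍ[ℝ]) q x⟩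
  have : IsScalarTower ℝ ℂ ℍ[ℝ] := ⟨fun r z q => by
    change ((r • z : ℂ) : ℍ[ℝ]) * q = r • ((z : ℍ[ℝ]) * q)
    rw [← smul_mul_assoc]
    congr 1
    ext <;> simp⟩
  have : Module.Finite ℂ ℍ[ℝ] := Module.Finite.of_restrictScalars_finite ℝ ℂ ℍ[ℝ]
  have : Module.Finite ℂ V := Module.Finite.trans ℍ[ℝ] V
  exact exists_jordan_chain_complex (fun _ _ => rfl) f

/-- The upper Jordan block of size `k` with eigenvalue `l`. -/
def jordanBlock (k : ℕ) (l : ℂ) : Matrix (Fin k) (Fin k) ℍ[ℝ] :=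
  fun i j => if j = i then (l : ℍ[ℝ]) else if (j : ℕ) = i + 1 then 1 else 0

/-- The direct sum of two square matrices. -/
def directSum {k m : ℕ} (K : Matrix (Fin k) (Fin k) ℍ[ℝ]) (L : Matrix (Fin m) (Fin m) ℍ[ℝ]) :
    Matrix (Fin (k + m)) (Fin (k + m)) ℍ[ℝ] :=
  (Matrix.fromBlocks K 0 0 L).submatrix finSumFinEquiv.symm finSumFinEquiv.symm

theorem isJordan_jordanBlock (k : ℕ) {l : ℂ} (hl : 0 ≤ l.im) : IsJordan (jordanBlock k l) where
  diag a := ⟨l, hl, by simp [jordanBlock]⟩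
  superdiag a b h := Or.inr ⟨by
    have : b ≠ a := fun h' => by rw [h'] at h; omega
    simp [jordanBlock, this, h], by simp [jordanBlock]⟩
  off a b h h' := by simp [jordanBlock, h, h']

theorem IsJordan.directSum {k m : ℕ} {K : Matrix (Fin k) (Fin k) ℍ[ℝ]}
    {L : Matrix (Fin m) (Fin m) ℍ[ℝ]} (hK : IsJordan K) (hL : IsJordan L) :
    IsJordan (directSum K L) where
  diag a := by
    refine Fin.addCases (fun a => ?_) (fun a => ?_) a
    · simpa [QT.directSum] using hK.diag a
    · simpa [QT.directSum] using hL.diag a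
  superdiag a b := by
    refine Fin.addCases (fun a => ?_) (fun a => ?_) a <;>
      refine Fin.addCases (fun b => ?_) (fun b => ?_) b <;> intro h
    · simpa [QT.directSum] using hK.superdiag a b (by simpa using h)
    · simp [QT.directSum]
    · simp [QT.directSum]
    · simpa [QT.directSum] using hL.superdiag a b (by simp at h; omega)
  off a b := by
    refine Fin.addCases (fun a => ?_) (fun a => ?_) a <;>
      refine Fin.addCases (fun b => ?_) (fun b => ?_) b <;> intro h h'
    · simpa [QT.directSum] using hK.off a b (fun e => h (by rw [e])) (by simpa using h')
    · simp [QT.directSum]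
    · simp [QT.directSum]
    · simpa [QT.directSum] using hL.off a b (fun e => h (by rw [e]))
        (fun e => h' (by simp; omega))

theorem sum_jordanBlock_smul {V : Type*} [AddCommGroup V] [Module ℍ[ℝ] V] {k : ℕ} (l : ℂ)
    {v : ℕ → V} (hv : v k = 0) (i : Fin k) :
    ∑ j, jordanBlock k l i j • v j = (l : ℍ[ℝ]) • v i + v (i + 1) := by
  have h : ∀ j : Fin k, jordanBlock k l i j • v j =
      (if j = i then (l : ℍ[ℝ]) • v j else 0) + if (j : ℕ) = i + 1 then v j else 0 := by
    intro j
    by_cases h₁ : j = i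
    · simp [jordanBlock, h₁]
    · by_cases h₂ : (j : ℕ) = i + 1 <;> simp [jordanBlock, h₁, h₂]
  simp_rw [h, Finset.sum_add_distrib, Finset.sum_ite_eq' Finset.univ i, if_pos (Finset.mem_univ i)]
  congr 1
  by_cases h₁ : (i : ℕ) + 1 < k
  · rw [Finset.sum_eq_single ⟨i + 1, h₁⟩]
    · simp
    · intro j _ hj
      rw [if_neg fun h => hj (Fin.ext h)]
    · simp
  · have h₂ : (i : ℕ) + 1 = k := by omega
    rw [h₂, hv]
    exact Finset.sum_eq_zero fun j _ => if_neg (by omega)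

/-- A combination of the vectors `v j` that is killed by an antitriangular system of functionals
is trivial. -/
theorem eq_zero_of_sum_mem_ker {V : Type*} [AddCommGroup V] [Module ℍ[ℝ] V] {k : ℕ} {v : ℕ → V}
    {φ : ℕ → V →ₗ[ℍ[ℝ]] ℍ[ℝ]} (h₀ : ∀ i j, k ≤ i + j → φ i (v j) = 0)
    (h₁ : ∀ i j, i + j + 1 = k → φ i (v j) ≠ 0) (c : Fin k → ℍ[ℝ])
    (hc : ∀ i < k, φ i (∑ j : Fin k, c j • v j) = 0) : ∀ j, c j = 0 := by
  have h : ∀ (m : ℕ) (hm : m < k), c ⟨m, hm⟩ = 0 := by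
    intro m
    induction m using Nat.strong_induction_on with
    | _ m ih =>
      intro hm
      -- This functional isolates the coefficient `m`: smaller ones vanish by induction, and it
      -- kills the later vectors.
      have h₂ := hc (k - 1 - m) (by omega)
      rw [map_sum, Finset.sum_eq_single ⟨m, hm⟩, map_smul, smul_eq_mul] at h₂
      · exact (mul_eq_zero.1 h₂).resolve_right (h₁ _ _ (by simp only; omega))
      · intro j _ hj
        rw [map_smul, smul_eq_mul]
        rcases lt_or_gt_of_ne (fun h => hj (Fin.ext h) : (j : ℕ) ≠ m) with h₃ | h₃
        · rw [ih j h₃ j.2, zero_mul]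
        · rw [h₀ _ _ (by omega), mul_zero]
      · simp
  exact fun j => h j j.2

/-- Induction on dimension. The kernel `W` of the dual chain is `f`-invariant, meets the span of the
chain trivially, and has codimension at most `k`, so it is a complement to which the induction
applies. -/
theorem exists_jordan_family (n : ℕ) : ∀ (V : Type) [AddCommGroup V] [Module ℍ[ℝ] V]
    [FiniteDimensional ℍ[ℝ] V] (f : V →ₗ[ℍ[ℝ]] V), Module.finrank ℍ[ℝ] V = n →
    ∃ (b : Fin n → V) (K : Matrix (Fin n) (Fin n) ℍ[ℝ]), LinearIndependent ℍ[ℝ] b ∧ IsJordan K ∧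
      ∀ i, f (b i) = ∑ j, K i j • b j := by
  induction n using Nat.strong_induction_on with
  | _ n ih =>
  intro V _ _ _ f hn
  rcases Nat.eq_zero_or_pos n with rfl | hpos
  · exact ⟨fun i => i.elim0, 0, linearIndependent_empty_type,
      ⟨fun a => a.elim0, fun a => a.elim0, fun a => a.elim0⟩, fun i => i.elim0⟩
  have : Nontrivial V := Module.nontrivial_of_finrank_pos (hn ▸ hpos)
  obtain ⟨k, l, v, φ, hk, hl, hfv, hvk, hφf, hφk, hφ₀, hφ₁⟩ := exists_jordan_chain f
  let Φ : V →ₗ[ℍ[ℝ]] (Fin k → ℍ[ℝ]) := LinearMap.pi fun i => φ i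
  let W := LinearMap.ker Φ
  have hW : ∀ w, w ∈ W ↔ ∀ i < k, φ i w = 0 := fun w => by
    refine ⟨fun h i hi => congrFun h ⟨i, hi⟩, fun h => funext fun i => h i i.2⟩
  have hWf : ∀ w ∈ W, f w ∈ W := by
    intro w hw
    rw [hW] at hw ⊢
    intro i hi
    rw [hφf, hw i hi, zero_mul, add_zero]
    rcases Nat.lt_or_ge (i + 1) k with h | h
    · exact hw _ h
    · obtain rfl : i + 1 = k := by omega
      rw [hφk, LinearMap.zero_apply]
  have hvind : LinearIndependent ℍ[ℝ] fun j : Fin k => v j := by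
    rw [Fintype.linearIndependent_iff]
    intro c hc
    refine eq_zero_of_sum_mem_ker hφ₀ hφ₁ c fun i _ => ?_
    rw [hc, map_zero]
  have hdisj : Disjoint (Submodule.span ℍ[ℝ] (Set.range fun j : Fin k => v j)) W := by
    rw [Submodule.disjoint_def]
    intro x hx hxW
    obtain ⟨c, rfl⟩ := (Submodule.mem_span_range_iff_exists_fun _).1 hx
    rw [hW] at hxW
    simp [eq_zero_of_sum_mem_ker hφ₀ hφ₁ c hxW]
  have hdim : k + Module.finrank ℍ[ℝ] W = n := by
    apply le_antisymm
    · have h := Submodule.finrank_add_finrank_le_of_disjoint hdisj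
      rwa [finrank_span_eq_card hvind, Fintype.card_fin, hn] at h
    · have h := Φ.finrank_range_add_finrank_ker
      have h' := Submodule.finrank_le (LinearMap.range Φ)
      rw [Module.finrank_fin_fun] at h'
      rw [hn] at h
      change _ + Module.finrank ℍ[ℝ] W = n at h
      omega
  obtain ⟨b, K, hb, hK, hfb⟩ := ih _ (by omega) W (f.restrict hWf) rfl
  generalize Module.finrank ℍ[ℝ] W = m at hdim b K hb hK hfb
  subst hdim
  have hfb' : ∀ i, f (b i : V) = ∑ j, K i j • (b j : V) := fun i => by
    have h := congrArg (Subtype.val) (hfb i)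
    rw [LinearMap.coe_restrict_apply] at h
    rw [h]
    simp
  refine ⟨fun i => Sum.elim (fun j : Fin k => v j) (fun j => (b j : V)) (finSumFinEquiv.symm i),
    directSum (jordanBlock k l) K, ?_, (isJordan_jordanBlock k hl).directSum hK, ?_⟩
  · refine LinearIndependent.comp (LinearIndependent.sum_type hvind
      (hb.map' W.subtype (Submodule.ker_subtype W)) (hdisj.mono_right ?_)) _
      finSumFinEquiv.symm.injective
    rw [Submodule.span_le]
    rintro _ ⟨j, rfl⟩
    exact (b j).2
  · intro i
    refine Fin.addCases (fun i => ?_) (fun i => ?_) i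
    · simp [directSum, Fin.sum_univ_add, hfv, sum_jordanBlock_smul l hvk]
    · simp [directSum, Fin.sum_univ_add, hfb']

/-- **Jordan canonical form** of a square quaternion matrix. -/
theorem exists_jordan_form {n : ℕ} (A : Matrix (Fin n) (Fin n) ℍ[ℝ]) :
    ∃ P Q K : Matrix (Fin n) (Fin n) ℍ[ℝ], P * Q = 1 ∧ Q * P = 1 ∧ IsJordan K ∧ A = P * K * Q := by
  -- Row vectors form a left `ℍ`-module on which `x ↦ x A` is linear. The Jordan basis becomes the
  -- rows of `B`, with `B * A = K * B`.
  obtain ⟨b, K, hb, hK, hA⟩ := exists_jordan_family n (Fin n → ℍ[ℝ]) A.vecMulLinear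
    (Module.finrank_fin_fun _)
  let B : Matrix (Fin n) (Fin n) ℍ[ℝ] := Matrix.of b
  have hBA : B * A = K * B := by
    ext1 i j
    have h := congrFun (hA i) j
    simpa [Matrix.vecMulLinear, Matrix.vecMul, dotProduct, Matrix.mul_apply, B] using h
  have hspan : ∀ x, x ∈ Submodule.span ℍ[ℝ] (Set.range b) := fun x => by
    rw [hb.span_eq_top_of_card_eq_finrank' (by simp)]
    trivial
  choose C hC using fun i => (Submodule.mem_span_range_iff_exists_fun ℍ[ℝ]).1
    (hspan ((1 : Matrix (Fin n) (Fin n) ℍ[ℝ]) i))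
  let P : Matrix (Fin n) (Fin n) ℍ[ℝ] := Matrix.of C
  have hPB : P * B = 1 := by
    ext1 i j
    have h := congrFun (hC i) j
    simpa [Matrix.mul_apply, P, B] using h
  have hBP : B * P = 1 := mul_eq_one_symm hPB
  refine ⟨P, B, K, hPB, hBP, hK, ?_⟩
  rw [Matrix.mul_assoc, ← hBA, ← Matrix.mul_assoc, hPB, Matrix.one_mul]

/-! ### Group inverses in monoids -/

/-- `x` is a group inverse of `a`. -/
def IsMonoidGroupInverse {M : Type*} [Monoid M] (a x : M) : Prop :=
  a * x * a = a ∧ x * a * x = x ∧ a * x = x * a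

theorem IsMonoidGroupInverse.unique {M : Type*} [Monoid M] {a x y : M}
    (hx : IsMonoidGroupInverse a x) (hy : IsMonoidGroupInverse a y) : x = y := by
  obtain ⟨h₁, h₂, h₃⟩ := hx
  obtain ⟨k₁, k₂, k₃⟩ := hy
  have h : a * x = a * y := by
    calc a * x = a * y * a * x := by rw [k₁]
      _ = y * (a * (a * x)) := by rw [k₃]; simp only [mul_assoc]
      _ = y * (a * x * a) := by rw [h₃]; simp only [mul_assoc, ← h₃]
      _ = a * y := by rw [h₁, k₃]
  calc x = x * (a * x) := by rw [← mul_assoc, h₂]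
    _ = a * x * y := by rw [h, ← mul_assoc, ← h₃, h]
    _ = y := by rw [h, k₃, k₂]

/-- Evaluating `z * a * a * y` in two ways gives `a * y = z * a`; this common element acts as an
identity on `a` from both sides, and `z * a * y` is the group inverse. -/
theorem exists_isMonoidGroupInverse {M : Type*} [Monoid M] {a y z : M} (hy : a = a * a * y)
    (hz : a = z * (a * a)) : ∃ x, IsMonoidGroupInverse a x := by
  have h : a * y = z * a := by
    calc a * y = z * (a * a) * y := by rw [← hz]
      _ = z * (a * a * y) := by rw [mul_assoc]
      _ = z * a := by rw [← hy]
  have h₁ : a * (a * y) = a := by rw [← mul_assoc, ← hy]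
  have h₂ : z * a * a = a := by rw [mul_assoc, ← hz]
  refine ⟨z * a * y, ?_, ?_, ?_⟩
  · calc a * (z * a * y) * a = a * (a * y) * y * a := by rw [← h]; simp only [mul_assoc]
      _ = a := by rw [h₁, h, h₂]
  · calc z * a * y * a * (z * a * y) = z * (a * y) * a * (z * a * y) := by simp only [mul_assoc]
      _ = z * (z * a * a) * (z * a * y) := by rw [h]; simp only [mul_assoc]
      _ = z * a * (a * y * y) := by rw [h₂, h]
      _ = z * (a * (a * y)) * y := by simp only [mul_assoc]
      _ = z * a * y := by rw [h₁]
  · calc a * (z * a * y) = a * (a * y) * y := by rw [← h]; simp only [mul_assoc]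
      _ = a * y := by rw [h₁]
      _ = z * a := h
      _ = z * (z * a * a) := by rw [h₂]
      _ = z * (a * y) * a := by rw [h]; simp only [mul_assoc]
      _ = z * a * y * a := by rw [mul_assoc z a y]

/-- In a left Artinian ring, `a ∈ a² R` implies `a ∈ R a²`. -/
theorem exists_eq_mul_sq_of_isArtinianRing {R : Type*} [Ring R] [IsArtinianRing R] {a y : R}
    (hy : a = a * a * y) : ∃ z, a = z * (a * a) := by
  obtain ⟨k, hk⟩ := IsArtinian.monotone_stabilizes (R := R) (M := R)
    ⟨fun i => OrderDual.toDual (Ideal.span {a ^ (i + 1)}), monotone_nat_of_le_succ fun i => by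
      change Ideal.span {a ^ (i + 1 + 1)} ≤ Ideal.span {a ^ (i + 1)}
      rw [Ideal.span_singleton_le_iff_mem, Ideal.mem_span_singleton', pow_succ' a (i + 1)]
      exact ⟨a, rfl⟩⟩
  have h₁ : Ideal.span {a ^ (k + 1)} = Ideal.span {a ^ (k + 1 + 1)} := hk (k + 1) (Nat.le_succ k)
  have h₂ : a ^ (k + 1) ∈ Ideal.span {a ^ (k + 1 + 1)} := by
    rw [← h₁]
    exact Ideal.mem_span_singleton_self _
  obtain ⟨z, hz⟩ := Ideal.mem_span_singleton'.1 h₂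
  -- The chain of left ideals only yields `a^(k+1) = z * a^(k+2)`; right multiplication by `y^k`
  -- strips off the surplus `a^k`.
  have h₃ : ∀ i : ℕ, a ^ (i + 1) * y ^ i = a := by
    intro i
    induction i with
    | zero => simp
    | succ i ih =>
      calc a ^ (i + 1 + 1) * y ^ (i + 1) = a ^ i * (a * a * y) * y ^ i := by
            rw [pow_succ, pow_succ, pow_succ']; simp only [mul_assoc]
        _ = a := by rw [← hy, ← pow_succ, ih]
  refine ⟨z, ?_⟩
  calc a = z * a ^ (k + 1 + 1) * y ^ k := by rw [hz, h₃]
    _ = z * (a * (a ^ (k + 1) * y ^ k)) := by rw [pow_succ' a (k + 1)]; simp only [mul_assoc]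
    _ = z * (a * a) := by rw [h₃]

/-! ### Ranks of quaternion matrices -/

theorem mem_span_columns_iff {ι κ : Type} [Fintype κ] (M : Matrix ι κ ℍ[ℝ]) (x : ι → ℍ[ℝ]) :
    x ∈ Submodule.span ℍ[ℝ]ᵐᵒᵖ (Set.range fun b : κ => fun a : ι => M a b) ↔
      ∃ c : κ → ℍ[ℝ], M *ᵥ c = x := by
  rw [Submodule.mem_span_range_iff_exists_fun]
  constructor
  · rintro ⟨c, rfl⟩
    refine ⟨fun b => (c b).unop, ?_⟩
    funext a
    simp [Matrix.mulVec, dotProduct]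
  · rintro ⟨c, rfl⟩
    refine ⟨fun b => MulOpposite.op (c b), ?_⟩
    funext a
    simp [Matrix.mulVec, dotProduct]

/-- The column space of `M * M` lies in that of `M`, so equal finite dimensions make them coincide;
each column of `M` is then `M * M` times a vector. -/
theorem exists_eq_sq_mul_of_quatRank_eq {ι : Type} [Fintype ι] (M : Matrix ι ι ℍ[ℝ])
    (h : quatRank (M * M) = quatRank M) : ∃ Y : Matrix ι ι ℍ[ℝ], M = M * M * Y := by
  classical
  have hle : Submodule.span ℍ[ℝ]ᵐᵒᵖ (Set.range fun b : ι => fun a : ι => (M * M) a b) ≤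
      Submodule.span ℍ[ℝ]ᵐᵒᵖ (Set.range fun b : ι => fun a : ι => M a b) := by
    intro x hx
    rw [mem_span_columns_iff] at hx ⊢
    obtain ⟨c, rfl⟩ := hx
    exact ⟨M *ᵥ c, Matrix.mulVec_mulVec _ _ _⟩
  have : FiniteDimensional ℍ[ℝ]ᵐᵒᵖ
      (Submodule.span ℍ[ℝ]ᵐᵒᵖ (Set.range fun b : ι => fun a : ι => M a b)) :=
    FiniteDimensional.span_of_finite _ (Set.finite_range _)
  have heq := Submodule.eq_of_le_of_finrank_eq hle h
  have hmem : ∀ b, ∃ c : ι → ℍ[ℝ], (M * M) *ᵥ c = fun a => M a b := fun b => by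
    rw [← mem_span_columns_iff, heq]
    exact Submodule.subset_span ⟨b, rfl⟩
  choose c hc using hmem
  refine ⟨Matrix.of fun a b => c b a, ?_⟩
  ext1 a b
  exact (congrFun (hc b) a).symm

/-! ### Transfer along the Fourier transform -/

theorem fourier_mul_eq (A B : Tensor ℍ[ℝ] n n n₃) : fourier (A *Q B) = fourier A * fourier B :=
  funext fun s => fourier_mul A B s

theorem isGroupInverse_iff (A X : Tensor ℍ[ℝ] n n n₃) :
    IsGroupInverse A X ↔ IsMonoidGroupInverse (fourier A) (fourier X) := by
  rw [IsMonoidGroupInverse]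
  simp only [← fourier_mul_eq, fourier_injective.eq_iff]
  exact ⟨fun h => ⟨h.1, h.2, h.3⟩, fun h => ⟨h.1, h.2.1, h.2.2⟩⟩

theorem isInverse_iff (P Q : Tensor ℍ[ℝ] n n n₃) :
    IsInverse P Q ↔ fourier P * fourier Q = 1 ∧ fourier Q * fourier P = 1 := by
  rw [IsInverse]
  simp only [← fourier_mul_eq, ← fourier_identity (n := n) (n₃ := n₃), fourier_injective.eq_iff]

theorem blockDiag_mul_blockDiag (A : Tensor ℍ[ℝ] n₁ r n₃) (B : Tensor ℍ[ℝ] r n₂ n₃) :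
    blockDiag A * blockDiag B = blockDiag fun s => A s * B s := by
  ext1 ⟨s, a⟩ ⟨t, b⟩
  rw [blockDiag_mul_apply]
  by_cases h : s = t <;> simp [blockDiag, h, Matrix.mul_apply]

theorem bcircZ_eq (A : Tensor ℍ[ℝ] n₁ n₂ n₃) :
    bcircZ A = dftKronStar n₁ n₃ * blockDiag (fourier A) * dftKron n₂ n₃ := by
  rw [Matrix.mul_assoc, ← dftKron_mul_bcircZ, ← Matrix.mul_assoc, dftKronStar_mul_dftKron,
    Matrix.one_mul]

theorem bcircZ_mul (A : Tensor ℍ[ℝ] n₁ r n₃) (B : Tensor ℍ[ℝ] r n₂ n₃) :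
    bcircZ (A *Q B) = bcircZ A * bcircZ B := by
  have h : fourier (A *Q B) = fun s => fourier A s * fourier B s :=
    funext fun s => fourier_mul A B s
  rw [bcircZ_eq A, Matrix.mul_assoc, dftKron_mul_bcircZ, bcircZ_eq (A *Q B), h,
    ← blockDiag_mul_blockDiag]
  simp only [Matrix.mul_assoc]

theorem identity_mul (A : Tensor ℍ[ℝ] n n n₃) : identity n n₃ *Q A = A := by
  apply fourier_injective
  rw [fourier_mul_eq, fourier_identity, one_mul]

theorem quatRank_bcircZ_of_index_eq_one {A : Tensor ℍ[ℝ] n n n₃} (hA : index A = 1) :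
    quatRank (bcircZ A * bcircZ A) = quatRank (bcircZ A) := by
  -- The infimum of the empty set is `0`, so index `1` guarantees that the infimum is attained.
  have hne : {k : ℕ | rank (pow A (k + 1)) = rank (pow A k)}.Nonempty := by
    rw [Set.nonempty_iff_ne_empty]
    intro h
    rw [index, h, Nat.sInf_empty] at hA
    exact zero_ne_one hA
  have h : rank (pow A (1 + 1)) = rank (pow A 1) := by
    have := Nat.sInf_mem hne
    rwa [← index, hA] at this
  simpa only [pow, identity_mul, rank, bcircZ_mul] using h

theorem exists_isGroupInverse_of_index_eq_one {A : Tensor ℍ[ℝ] n n n₃} (hA : index A = 1) :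
    ∃ X, IsGroupInverse A X := by
  obtain ⟨Y, hY⟩ := exists_eq_sq_mul_of_quatRank_eq _ (quatRank_bcircZ_of_index_eq_one hA)
  set D := fourier A with hD
  have h₁ : blockDiag D = blockDiag (D * D) * (dftKron n n₃ * Y * dftKronStar n n₃) := by
    have h := congrArg (fun M => dftKron n n₃ * M * dftKronStar n n₃) hY
    simp only [← Matrix.mul_assoc] at h
    rw [dftKron_mul_bcircZ_mul, dftKron_mul_bcircZ, Matrix.mul_assoc (blockDiag _),
      dftKron_mul_bcircZ, ← Matrix.mul_assoc (blockDiag _), blockDiag_mul_blockDiag] at h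
    rw [h]
    simp only [Matrix.mul_assoc]
    rfl
  set Z := dftKron n n₃ * Y * dftKronStar n n₃ with hZ
  -- `Z` need not be block diagonal: since the left factor is, the diagonal blocks of `Z` alone give
  -- the equation slice by slice.
  have h₂ : D = D * D * fun s => Matrix.of fun a b => Z (s, a) (s, b) := by
    funext s
    ext1 a b
    have h := congrFun (congrFun h₁ (s, a)) (s, b)
    rw [blockDiag_mul_apply, blockDiag, if_pos rfl] at h
    exact h
  obtain ⟨z, hz⟩ := exists_eq_mul_sq_of_isArtinianRing h₂
  obtain ⟨x, hx⟩ := exists_isMonoidGroupInverse h₂ hz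
  exact ⟨invFourier x, by rwa [isGroupInverse_iff, fourier_invFourier]⟩

theorem exists_isJordanDecomposition (A : Tensor ℍ[ℝ] n n n₃) :
    ∃ P Pinv J : Tensor ℍ[ℝ] n n n₃, IsJordanDecomposition A P Pinv J := by
  choose P Q K hPQ hQP hK hA using fun s => exists_jordan_form (fourier A s)
  refine ⟨invFourier P, invFourier Q, invFourier K, ?_, ?_, ?_⟩
  · simp only [isInverse_iff, fourier_invFourier]
    exact ⟨funext hPQ, funext hQP⟩
  · apply fourier_injective
    simp only [fourier_mul_eq, fourier_invFourier]
    exact funext hA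
  · rw [hat_eq_fourier, fourier_invFourier]
    exact hK

theorem IsGroupInverse.unique {A X Y : Tensor ℍ[ℝ] n n n₃} (hX : IsGroupInverse A X)
    (hY : IsGroupInverse A Y) : X = Y :=
  fourier_injective (((isGroupInverse_iff A X).1 hX).unique ((isGroupInverse_iff A Y).1 hY))

theorem IsMonoidGroupInverse.conj {M : Type*} [Monoid M] {a x p q : M}
    (h : IsMonoidGroupInverse a x) (hqp : q * p = 1) :
    IsMonoidGroupInverse (p * a * q) (p * x * q) := by
  obtain ⟨h₁, h₂, h₃⟩ := h
  have hmul : ∀ b c, p * b * q * (p * c * q) = p * (b * c) * q := fun b c => by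
    calc p * b * q * (p * c * q) = p * b * (q * p) * c * q := by simp only [mul_assoc]
      _ = p * (b * c) * q := by rw [hqp, mul_one]; simp only [mul_assoc]
  refine ⟨?_, ?_, ?_⟩
  · rw [hmul, hmul, h₁]
  · rw [hmul, hmul, h₂]
  · rw [hmul, hmul, h₃]

theorem IsGroupInverse.conj {A X P Q : Tensor ℍ[ℝ] n n n₃} (h : IsGroupInverse A X)
    (hPQ : IsInverse P Q) : IsGroupInverse (P *Q A *Q Q) (P *Q X *Q Q) := by
  rw [isGroupInverse_iff] at h ⊢
  simp only [fourier_mul_eq]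
  exact h.conj ((isInverse_iff P Q).1 hPQ).2

theorem IsJordanDecomposition.eq_conj {A P Pinv J : Tensor ℍ[ℝ] n n n₃}
    (h : IsJordanDecomposition A P Pinv J) : J = Pinv *Q A *Q P := by
  apply fourier_injective
  have h₁ := ((isInverse_iff P Pinv).1 h.isInverse).2
  rw [h.eq]
  simp only [fourier_mul_eq]
  calc fourier J = fourier Pinv * fourier P * fourier J * (fourier Pinv * fourier P) := by
        rw [h₁, one_mul, mul_one]
    _ = _ := by simp only [mul_assoc]

end QT

end

theorem mainTheorem9 (n n₃ : ℕ) [NeZero n₃] (A : QT.Tensor ℍ[ℝ] n n n₃)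
    (hA : QT.index A = 1) :
    (∃ P Pinv J : QT.Tensor ℍ[ℝ] n n n₃, QT.IsJordanDecomposition A P Pinv J) ∧
    ∀ P Pinv J : QT.Tensor ℍ[ℝ] n n n₃, QT.IsJordanDecomposition A P Pinv J →
      (∃! X, QT.IsGroupInverse A X) ∧ (∃! Y, QT.IsGroupInverse J Y) ∧
      ∀ X Y : QT.Tensor ℍ[ℝ] n n n₃, QT.IsGroupInverse A X → QT.IsGroupInverse J Y →
        X = P *Q Y *Q Pinv := by
  refine ⟨QT.exists_isJordanDecomposition A, fun P Pinv J h => ?_⟩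
  obtain ⟨X, hX⟩ := QT.exists_isGroupInverse_of_index_eq_one hA
  refine ⟨⟨X, hX, fun _ h' => h'.unique hX⟩, ⟨Pinv *Q X *Q P, ?_, ?_⟩, ?_⟩
  · rw [h.eq_conj]
    exact hX.conj ⟨h.isInverse.2, h.isInverse.1⟩
  · intro Y hY
    refine hY.unique ?_
    rw [h.eq_conj]
    exact hX.conj ⟨h.isInverse.2, h.isInverse.1⟩
  · intro X Y hX hY
    refine hX.unique ?_
    rw [h.eq]
    exact hY.conj h.isInverse
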